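/- Let $T\subseteq\mathbb R$ be an open interval, let $F$ be a smooth manifold without boundary (of finite dimension), let $(g_t)_{t\in T}$ be a family of Riemannian metrics on $F$ depending smoothly on $(t,p)\in T\times F$, and let $\beta\in C^\infty(T\times F)$ be positive (in particular, $\beta$ may be a function of $t$ alone). Endow $T\times F$ with the Riemannian metric $\overline g=\beta\,dt^2+g_t$, where $dt^2$ and $g_t$ are pulled back along the projections onto $T$ and $F$. The manifold $(T\times F,\overline g)$ is called \emph{expanding} throughout $\partial_t$ if $$\partial_t\beta\ge 0\quad\text{and}\quad (\partial_t g_t)(X,X)>0\ \text{ for all } t\in T,\ p\in F,\ 0\neq X\in T_pF,$$ \emph{contracting} throughout $\partial_t$ if $\partial_t\beta\le 0$ and $(\partial_t g_t)(X,X)<0$ for all such $t,p,X$, and \emph{strictly monotone} if it is expanding or contracting throughout $\partial_t$. If $(T\times F,\overline g)$ is strictly monotone, then it contains no compact minimal submanifold of positive dimension. That is, for every $n\ge 1$ and every non-empty compact smooth $n$-dimensional manifold $S$ without boundary, no smooth immersion $x:S\to T\times F$ has identically vanishing mean curvature vector $$H=\frac1n\sum_{i=1}^n \mathrm{II}(E_i,E_i),$$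 where $\mathrm{II}(X,Y)=(\overline\nabla_XY)^\perp$ is the second fundamental form of $x$, $\overline\nabla$ is the Levi-Civita connection of $\overline g$, and $(E_i)$ is an orthonormal basis of the tangent space of $S$ for the induced metric. -/

import Mathlib

open Set Filter Topology Bundle Manifold ContDiff TopologicalSpace

noncomputable section PullbackForm

variable {E : Type*} [NormedAddCommGroup E] [NormedSpace ℝ E]
  {H : Type*} [TopologicalSpace H] {I : ModelWithCorners ℝ E H}
  {M : Type*} [TopologicalSpace M] [ChartedSpace H M]
  {E' : Type*} [NormedAddCommGroup E'] [NormedSpace ℝ E']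
  {H' : Type*} [TopologicalSpace H'] {I' : ModelWithCorners ℝ E' H'}
  {N : Type*} [TopologicalSpace N] [ChartedSpace H' N]

/-- The pullback `(u, v) ↦ h (A u) (A v)` of a bilinear form `h` under a linear map `A`. -/
def pullForm {V W : Type*} [AddCommGroup V] [Module ℝ V] [TopologicalSpace V]
    [AddCommGroup W] [Module ℝ W] [TopologicalSpace W]
    [IsTopologicalAddGroup V] [ContinuousConstSMul ℝ V]
    [IsTopologicalAddGroup W] [ContinuousConstSMul ℝ W]
    (h : W →L[ℝ] W →L[ℝ] ℝ) (A : V →L[ℝ] W) : V →L[ℝ] V →L[ℝ] ℝ :=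
  (ContinuousLinearMap.precomp ℝ A) ∘L h ∘L A

@[simp] theorem pullForm_apply {V W : Type*} [AddCommGroup V] [Module ℝ V] [TopologicalSpace V]
    [AddCommGroup W] [Module ℝ W] [TopologicalSpace W]
    [IsTopologicalAddGroup V] [ContinuousConstSMul ℝ V]
    [IsTopologicalAddGroup W] [ContinuousConstSMul ℝ W]
    (h : W →L[ℝ] W →L[ℝ] ℝ) (A : V →L[ℝ] W) (u v : V) :
    pullForm h A u v = h (A u) (A v) := rfl

theorem contMDiff_pullForm [IsManifold I ∞ M] [IsManifold I' ∞ N] {f : M → N}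
    (hf : ContMDiff I I' ∞ f)
    (h : ∀ x, TangentSpace I' (f x) →L[ℝ] TangentSpace I' (f x) →L[ℝ] ℝ)
    (hh : ContMDiff I (I'.prod 𝓘(ℝ, E' →L[ℝ] E' →L[ℝ] ℝ)) ∞
      (fun x ↦ TotalSpace.mk' (E' →L[ℝ] E' →L[ℝ] ℝ)
        (E := fun y : N ↦ TangentSpace I' y →L[ℝ] TangentSpace I' y →L[ℝ] ℝ) (f x) (h x))) :
    ContMDiff I (I.prod 𝓘(ℝ, E →L[ℝ] E →L[ℝ] ℝ)) ∞
      (fun x ↦ TotalSpace.mk' (E →L[ℝ] E →L[ℝ] ℝ)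
        (E := fun y : M ↦ TangentSpace I y →L[ℝ] TangentSpace I y →L[ℝ] ℝ) x
        (pullForm (h x) (mfderiv I I' f x))) := by
  have : IsManifold I 1 M := IsManifold.of_le (n := ∞) (by norm_num)
  have : IsManifold I' 1 N := IsManifold.of_le (n := ∞) (by norm_num)
  intro x₀
  have h1 := ((contMDiffAt_hom_bundle _).1 (hh x₀)).2
  have h2 := (hf x₀).mfderiv_const (m := ∞) (by simp)
  rw [contMDiffAt_hom_bundle]
  refine ⟨contMDiffAt_id, ?_⟩
  have h3 := (h2.clm_precomp (F₃ := ℝ)).clm_comp (h1.clm_comp h2)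
  refine h3.congr_of_eventuallyEq ?_
  have n1 : ∀ᶠ x in 𝓝 x₀, x ∈ (trivializationAt E (TangentSpace I) x₀).baseSet :=
    (trivializationAt E (TangentSpace I) x₀).open_baseSet.mem_nhds
      (FiberBundle.mem_baseSet_trivializationAt' x₀)
  have n2 : ∀ᶠ x in 𝓝 x₀, f x ∈ (trivializationAt E' (TangentSpace I') (f x₀)).baseSet :=
    (hf x₀).continuousAt
      ((trivializationAt E' (TangentSpace I') (f x₀)).open_baseSet.mem_nhds
      (FiberBundle.mem_baseSet_trivializationAt' (f x₀)))
  filter_upwards [n1, n2] with x m1 m2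
  ext u v
  rw [inCoordinates_apply_eq₂ m1 m1 (Set.mem_univ _)]
  simp only [ContinuousLinearMap.comp_apply, inTangentCoordinates,
    ContinuousLinearMap.precomp_apply]
  rw [inCoordinates_apply_eq₂ m2 m2 (Set.mem_univ _)]
  have key : ∀ w : E, (trivializationAt E' (TangentSpace I') (f x₀)).symm (f x)
      (ContinuousLinearMap.inCoordinates E (TangentSpace I) E' (TangentSpace I') x₀ x (f x₀) (f x)
        (mfderiv I I' f x) w) =
      mfderiv I I' f x ((trivializationAt E (TangentSpace I) x₀).symm x w) := by
    intro w
    rw [ContinuousLinearMap.inCoordinates_eq m1 m2]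
    simp [Bundle.Trivialization.symm_apply_apply_mk _ m2]
  erw [key, key]
  rfl

theorem isVonNBounded_of_posDef {E : Type*} [NormedAddCommGroup E] [NormedSpace ℝ E]
    [FiniteDimensional ℝ E] (B : E →L[ℝ] E →L[ℝ] ℝ) (hB : ∀ v, v ≠ 0 → 0 < B v v) :
    Bornology.IsVonNBounded ℝ {v : E | B v v < 1} := by
  rw [NormedSpace.isVonNBounded_iff]
  have hc : Continuous fun v : E ↦ B v v := by fun_prop
  rcases (Metric.sphere (0 : E) 1).eq_empty_or_nonempty with he | hne
  · have : ∀ v : E, v = 0 := by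
      intro v
      by_contra hv
      have : ‖v‖⁻¹ • v ∈ Metric.sphere (0 : E) 1 := by
        simp [norm_smul, hv]
      simp [he] at this
    exact (Bornology.isBounded_singleton (x := (0 : E))).subset fun v _ ↦ this v
  · obtain ⟨w, hw, hmin⟩ := (isCompact_sphere (0 : E) 1).exists_isMinOn hne hc.continuousOn
    have hw0 : w ≠ 0 := by rintro rfl; simp at hw
    have hpos := hB w hw0
    refine (Metric.isBounded_ball (x := (0 : E)) (r := 1 + 1 / B w w)).subset ?_
    intro v hv
    rw [mem_ball_zero_iff]
    by_cases hv0 : v = 0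
    · subst hv0; simp; positivity
    have hn : 0 < ‖v‖ := norm_pos_iff.2 hv0
    have h1 : B w w ≤ B (‖v‖⁻¹ • v) (‖v‖⁻¹ • v) := hmin (by simp [norm_smul, hv0])
    have h2 : B w w * ‖v‖ ^ 2 ≤ B v v := by
      simp only [map_smul, smul_apply, smul_eq_mul] at h1
      have := mul_le_mul_of_nonneg_right h1 (sq_nonneg ‖v‖)
      refine this.trans_eq ?_
      field_simp
    have h3 : B w w * ‖v‖ ^ 2 < 1 := h2.trans_lt hv
    by_contra! h4
    have h5 : 1 ≤ ‖v‖ := le_trans (by simp; positivity) h4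
    have h6 : 1 / B w w < ‖v‖ := by linarith
    rw [div_lt_iff₀ hpos] at h6
    nlinarith

end PullbackForm

noncomputable section InnerAlgebra

variable {V : Type*} [AddCommGroup V] [Module ℝ V] [FiniteDimensional ℝ V]

/-- The vector representing a linear form `ℓ` with respect to the inner product `c`. -/
def sharp (c : InnerProductSpace.Core ℝ V) (ℓ : V →ₗ[ℝ] ℝ) : V :=
  letI : NormedAddCommGroup V := c.toNormedAddCommGroup
  letI : InnerProductSpace ℝ V := .ofCore c.toCore
  haveI : CompleteSpace V := FiniteDimensional.complete ℝ V
  (InnerProductSpace.toDual ℝ V).symm (LinearMap.toContinuousLinearMap ℓ)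

/-- The component of `w` orthogonal to the subspace `W` with respect to the inner product `c`. -/
def normalPart (c : InnerProductSpace.Core ℝ V) (W : Submodule ℝ V) (w : V) : V :=
  letI : NormedAddCommGroup V := c.toNormedAddCommGroup
  letI : InnerProductSpace ℝ V := .ofCore c.toCore
  haveI : CompleteSpace V := FiniteDimensional.complete ℝ V
  Wᗮ.starProjection w

/-- The trace `∑ i, B (e i) (e i)` over an orthonormal basis `e` for the inner product `c`. -/
def traceForm (c : InnerProductSpace.Core ℝ V) {W : Type*} [AddCommMonoid W]
    (B : V → V → W) : W :=
  letI : NormedAddCommGroup V := c.toNormedAddCommGroup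
  letI : InnerProductSpace ℝ V := .ofCore c.toCore
  ∑ i, B (stdOrthonormalBasis ℝ V i) (stdOrthonormalBasis ℝ V i)

end InnerAlgebra

noncomputable section Submanifold

variable {E : Type*} [NormedAddCommGroup E] [NormedSpace ℝ E] [FiniteDimensional ℝ E]
  {H : Type*} [TopologicalSpace H] {I : ModelWithCorners ℝ E H}
  {M : Type*} [TopologicalSpace M] [ChartedSpace H M] [IsManifold I ∞ M]
  {E' : Type*} [NormedAddCommGroup E'] [NormedSpace ℝ E'] [FiniteDimensional ℝ E']
  {H' : Type*} [TopologicalSpace H'] {I' : ModelWithCorners ℝ E' H'}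
  {S : Type*} [TopologicalSpace S] [ChartedSpace H' S]

instance tangentSpaceFiniteDimensional (x : M) : FiniteDimensional ℝ (TangentSpace I x) :=
  inferInstanceAs (FiniteDimensional ℝ E)

/-- The metric `g` read in the preferred chart at `x₀`, as a field of bilinear forms on `E`. -/
def coordMetric (g : ContMDiffRiemannianMetric I ∞ E (fun x : M ↦ TangentSpace I x)) (x₀ : M)
    (y : E) : E →L[ℝ] E →L[ℝ] ℝ :=
  pullForm (V := E) (g.inner ((extChartAt I x₀).symm y))
    (mfderiv 𝓘(ℝ, E) I (extChartAt I x₀).symm y)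

/-- The Christoffel symbol of the first kind at `x₀` in the preferred chart at `x₀`: the form
`w ↦ (∂_u g(v, w) + ∂_v g(u, w) - ∂_w g(u, v)) / 2`. -/
def christoffelLower (g : ContMDiffRiemannianMetric I ∞ E (fun x : M ↦ TangentSpace I x)) (x₀ : M)
    (u v : E) : E →L[ℝ] ℝ :=
  let D := fderiv ℝ (coordMetric g x₀) (extChartAt I x₀ x₀)
  (1 / 2 : ℝ) • (D u v + D v u - (D.flip u).flip v)

/-- The Christoffel symbol `Γ(u, v)` of the Levi-Civita connection of `g` at `x₀`, in the preferred
chart at `x₀` (in Mathlib `TangentSpace I x₀` is `E`, identified through this chart). -/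
def christoffel (g : ContMDiffRiemannianMetric I ∞ E (fun x : M ↦ TangentSpace I x)) (x₀ : M)
    (u v : TangentSpace I x₀) : TangentSpace I x₀ :=
  sharp (g.toRiemannianMetric.toCore x₀) (christoffelLower g x₀ u v).toLinearMap

/-- A smooth immersion `f : S → M`, that is, an (immersed) submanifold of `M`. -/
structure IsSmoothImmersion (I' : ModelWithCorners ℝ E' H') (I : ModelWithCorners ℝ E H)
    (f : S → M) : Prop where
  contMDiff : ContMDiff I' I ∞ f
  injective_mfderiv : ∀ p, Function.Injective (mfderiv I' I f p)

/-- The Levi-Civita derivative `∇_X (df Y)` at `p`, where `X`, `Y` are the fields on `S` that have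
constant components `u`, `v` in the preferred chart at `p`: its expression in the preferred charts
at `p` and `f p` is `D²f(u, v) + Γ(df u, df v)`. (Manifolds without boundary.) -/
def covariantHessian (g : ContMDiffRiemannianMetric I ∞ E (fun x : M ↦ TangentSpace I x))
    (I' : ModelWithCorners ℝ E' H') (f : S → M) (p : S) (u v : TangentSpace I' p) :
    TangentSpace I (f p) :=
  (show TangentSpace I (f p) from
    fderiv ℝ (fderiv ℝ (writtenInExtChartAt I' I p f)) (extChartAt I' p p) u v) +
  christoffel g (f p) (mfderiv I' I f p u) (mfderiv I' I f p v)

/-- The second fundamental form `II(u, v) = (∇_u v)^⊥` of the immersion `f`. -/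
def secondFundamentalForm (g : ContMDiffRiemannianMetric I ∞ E (fun x : M ↦ TangentSpace I x))
    (I' : ModelWithCorners ℝ E' H') (f : S → M) (p : S) (u v : TangentSpace I' p) :
    TangentSpace I (f p) :=
  normalPart (g.toRiemannianMetric.toCore (f p))
    (LinearMap.range (mfderiv I' I f p).toLinearMap) (covariantHessian g I' f p u v)

/-- The metric induced on `T_p S` by the immersion `f`. -/
@[reducible] def inducedCore
    (g : ContMDiffRiemannianMetric I ∞ E (fun x : M ↦ TangentSpace I x))
    {f : S → M} (hf : IsSmoothImmersion I' I f) (p : S) :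
    InnerProductSpace.Core ℝ (TangentSpace I' p) where
  inner u v := g.inner (f p) (mfderiv I' I f p u) (mfderiv I' I f p v)
  conj_inner_symm u v := g.symm _ _ _
  re_inner_nonneg u := by
    rcases eq_or_ne (mfderiv I' I f p u) 0 with h | h
    · simp [h]
    · simpa using (g.pos _ _ h).le
  add_left u v w := by simp
  smul_left c u := by simp
  definite u h := by
    by_contra hu
    exact (g.pos (f p) (mfderiv I' I f p u)
      fun h0 ↦ hu (hf.injective_mfderiv p (h0.trans (map_zero _).symm))).ne' h

/-- The mean curvature vector `H = (1 / n) ∑ i, II(e i, e i)` at `p`, where `n = dim S` and `e` is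
an orthonormal basis of `T_p S`. -/
def meanCurvature (g : ContMDiffRiemannianMetric I ∞ E (fun x : M ↦ TangentSpace I x))
    {f : S → M} (hf : IsSmoothImmersion I' I f) (p : S) : TangentSpace I (f p) :=
  (1 / (Module.finrank ℝ E' : ℝ)) • traceForm (inducedCore g hf p) (secondFundamentalForm g I' f p)

/-- The immersed submanifold `f : S → M` is minimal: its mean curvature vanishes. -/
def IsMinimal (g : ContMDiffRiemannianMetric I ∞ E (fun x : M ↦ TangentSpace I x))
    {f : S → M} (hf : IsSmoothImmersion I' I f) : Prop :=
  ∀ p, meanCurvature g hf p = 0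

end Submanifold

noncomputable section Ambient

variable {E : Type*} [NormedAddCommGroup E] [NormedSpace ℝ E]
  {H : Type*} [TopologicalSpace H] {J : ModelWithCorners ℝ E H}
  {F : Type*} [TopologicalSpace F] [ChartedSpace H F] [IsManifold J ∞ F] {T : Opens ℝ}

/-- A family of Riemannian metrics `g_t` on `F`, `t ∈ T`, is smooth: `(t, p) ↦ g_t(p)` is. -/
def IsSmoothFamily (g : T → ContMDiffRiemannianMetric J ∞ E (fun p : F ↦ TangentSpace J p)) :
    Prop :=
  ContMDiff (𝓘(ℝ, ℝ).prod J) (J.prod 𝓘(ℝ, E →L[ℝ] E →L[ℝ] ℝ)) ∞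
    (fun q : T × F ↦ TotalSpace.mk' (E →L[ℝ] E →L[ℝ] ℝ)
      (E := fun p : F ↦ TangentSpace J p →L[ℝ] TangentSpace J p →L[ℝ] ℝ) q.2 ((g q.1).inner q.2))

/-- The bilinear form `β dt² + g_t` on the tangent space of `T × F` at `q`, where `dt` is the
differential of the coordinate `t : T × F → ℝ`, and `g_t` is pulled back along the projection
to `F`. -/
def productForm (β : T × F → ℝ)
    (g : T → ContMDiffRiemannianMetric J ∞ E (fun p : F ↦ TangentSpace J p)) (q : T × F) :
    TangentSpace (𝓘(ℝ, ℝ).prod J) q →L[ℝ] TangentSpace (𝓘(ℝ, ℝ).prod J) q →L[ℝ] ℝ :=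
  β q • pullForm ((riemannianMetricVectorSpace ℝ).inner (q.1 : ℝ))
      (mfderiv (𝓘(ℝ, ℝ).prod J) 𝓘(ℝ, ℝ) (fun q : T × F ↦ (q.1 : ℝ)) q) +
    pullForm ((g q.1).inner q.2) (mfderiv (𝓘(ℝ, ℝ).prod J) J (Prod.snd : T × F → F) q)

theorem hasMFDerivAt_opens_val (t : T) :
    HasMFDerivAt 𝓘(ℝ, ℝ) 𝓘(ℝ, ℝ) (Subtype.val : T → ℝ) t
      (ContinuousLinearMap.id ℝ ℝ) := by
  refine ⟨continuous_subtype_val.continuousAt, ?_⟩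
  refine (hasFDerivWithinAt_id (𝕜 := ℝ) _ _).congr_of_eventuallyEq ?_ ?_
  · filter_upwards [extChartAt_target_mem_nhdsWithin (I := 𝓘(ℝ, ℝ)) t] with y hy
    exact (extChartAt 𝓘(ℝ, ℝ) t).right_inv hy
  · exact (extChartAt 𝓘(ℝ, ℝ) t).right_inv (mem_extChartAt_target t)

theorem productForm_apply (β : T × F → ℝ)
    (g : T → ContMDiffRiemannianMetric J ∞ E (fun p : F ↦ TangentSpace J p)) (q : T × F)
    (u v : TangentSpace (𝓘(ℝ, ℝ).prod J) q) :
    productForm β g q u v =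
      β q * (riemannianMetricVectorSpace ℝ).inner (q.1 : ℝ)
        (mfderiv (𝓘(ℝ, ℝ).prod J) 𝓘(ℝ, ℝ) (fun q : T × F ↦ (q.1 : ℝ)) q u)
        (mfderiv (𝓘(ℝ, ℝ).prod J) 𝓘(ℝ, ℝ) (fun q : T × F ↦ (q.1 : ℝ)) q v) +
      (g q.1).inner q.2 (mfderiv (𝓘(ℝ, ℝ).prod J) J (Prod.snd : T × F → F) q u)
        (mfderiv (𝓘(ℝ, ℝ).prod J) J (Prod.snd : T × F → F) q v) := rfl

theorem productForm_pos (β : T × F → ℝ) (hβ0 : ∀ q, 0 < β q)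
    (g : T → ContMDiffRiemannianMetric J ∞ E (fun p : F ↦ TangentSpace J p)) (q : T × F)
    (u : TangentSpace (𝓘(ℝ, ℝ).prod J) q) (hu : u ≠ 0) : 0 < productForm β g q u u := by
  rw [productForm_apply]
  have h1 : mfderiv (𝓘(ℝ, ℝ).prod J) 𝓘(ℝ, ℝ) (fun q : T × F ↦ (q.1 : ℝ)) q =
      ContinuousLinearMap.fst ℝ ℝ E :=
    ((hasMFDerivAt_opens_val q.1).comp q
      (hasMFDerivAt_fst (I := 𝓘(ℝ, ℝ)) (I' := J) (x := q))).mfderiv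
  have h2 : mfderiv (𝓘(ℝ, ℝ).prod J) J (Prod.snd : T × F → F) q =
      ContinuousLinearMap.snd ℝ ℝ E :=
    (hasMFDerivAt_snd (I := 𝓘(ℝ, ℝ)) (I' := J) (x := q)).mfderiv
  set a := mfderiv (𝓘(ℝ, ℝ).prod J) 𝓘(ℝ, ℝ) (fun q : T × F ↦ (q.1 : ℝ)) q u with ha
  set b := mfderiv (𝓘(ℝ, ℝ).prod J) J (Prod.snd : T × F → F) q u with hb
  by_cases ha0 : a = 0
  · have hb0 : b ≠ 0 := by
      intro hb0
      rw [h1] at ha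
      rw [h2] at hb
      exact hu (Prod.ext (ha.symm.trans ha0) (hb.symm.trans hb0))
    simpa [ha0] using (g q.1).pos q.2 b hb0
  · have p1 := mul_pos (hβ0 q) ((riemannianMetricVectorSpace ℝ).pos (q.1 : ℝ) a ha0)
    rcases eq_or_ne b 0 with hb0 | hb0
    · simpa [hb0] using p1
    · exact add_pos p1 ((g q.1).pos q.2 b hb0)

/-- The Riemannian metric `β dt² + g_t` on `T × F`. -/
def productMetric [FiniteDimensional ℝ E] (β : T × F → ℝ)
    (hβ : ContMDiff (𝓘(ℝ, ℝ).prod J) 𝓘(ℝ, ℝ) ∞ β) (hβ0 : ∀ q, 0 < β q)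
    (g : T → ContMDiffRiemannianMetric J ∞ E (fun p : F ↦ TangentSpace J p))
    (hg : IsSmoothFamily g) :
    ContMDiffRiemannianMetric (𝓘(ℝ, ℝ).prod J) ∞ (ℝ × E)
      (fun q : T × F ↦ TangentSpace (𝓘(ℝ, ℝ).prod J) q) where
  inner := productForm β g
  symm q u v := by
    rw [productForm_apply, productForm_apply, (g q.1).symm, (riemannianMetricVectorSpace ℝ).symm]
  pos := productForm_pos β hβ0 g
  isVonNBounded q :=
    isVonNBounded_of_posDef (E := ℝ × E) (productForm β g q) (productForm_pos β hβ0 g q)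
  contMDiff := by
    have h1 : ContMDiff (𝓘(ℝ, ℝ).prod J) 𝓘(ℝ, ℝ) ∞ (fun q : T × F ↦ (q.1 : ℝ)) :=
      contMDiff_subtype_val.comp contMDiff_fst
    have h2 := contMDiff_pullForm h1 (fun q ↦ (riemannianMetricVectorSpace ℝ).inner (q.1 : ℝ))
      (((riemannianMetricVectorSpace ℝ).contMDiff.of_le (by simp)).comp h1)
    have h3 := contMDiff_pullForm (contMDiff_snd (I := 𝓘(ℝ, ℝ)) (J := J) (M := T) (N := F))
      (fun q ↦ (g q.1).inner q.2) hg
    exact (hβ.smul_section h2).add_section h3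

/-- The derivative `∂_t φ` at `t` of a function on the open interval `T`. -/
def timeDeriv (φ : T → ℝ) (t : T) : ℝ :=
  mfderiv 𝓘(ℝ, ℝ) 𝓘(ℝ, ℝ) φ t (1 : ℝ)

/-- `β dt² + g_t` is expanding throughout `∂_t`. -/
def IsExpanding (β : T × F → ℝ)
    (g : T → ContMDiffRiemannianMetric J ∞ E (fun p : F ↦ TangentSpace J p)) : Prop :=
  (∀ t p, 0 ≤ timeDeriv (fun s ↦ β (s, p)) t) ∧
    ∀ t p (X : TangentSpace J p), X ≠ 0 → 0 < timeDeriv (fun s ↦ (g s).inner p X X) t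

/-- `β dt² + g_t` is contracting throughout `∂_t`, i.e. expanding throughout `-∂_t`. -/
def IsContracting (β : T × F → ℝ)
    (g : T → ContMDiffRiemannianMetric J ∞ E (fun p : F ↦ TangentSpace J p)) : Prop :=
  (∀ t p, timeDeriv (fun s ↦ β (s, p)) t ≤ 0) ∧
    ∀ t p (X : TangentSpace J p), X ≠ 0 → timeDeriv (fun s ↦ (g s).inner p X X) t < 0

/-- `β dt² + g_t` is strictly monotone: expanding or contracting throughout `∂_t`. -/
def IsStrictlyMonotone (β : T × F → ℝ)
    (g : T → ContMDiffRiemannianMetric J ∞ E (fun p : F ↦ TangentSpace J p)) : Prop :=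
  IsExpanding β g ∨ IsContracting β g

end Ambient

/-!
The theorem follows from a maximum principle for the height `t ∘ f` on the compact manifold `S`.

In the expanding case let `p` be a point where `t ∘ f` is maximal. There the tangent space of `S` is
contained in the kernel of `dt`, so `∂_t` is normal to it. Because the metric `β dt² + g_t` is block
diagonal, the Christoffel symbols satisfy `⟨Γ(w, w), ∂_t⟩ = - (∂_t g_t)(w, w) / 2` for vectors `w`
tangent to `F` (`christoffelLower_productMetric`). Hence, with `X` the `F`-component of `df u`,
`⟨II(u, u), ∂_t⟩ = β D²(t ∘ f)(u, u) - (∂_t g_t)(X, X) / 2`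
(`mul_fst_secondFundamentalForm`). The first term is nonpositive at a maximum
(`IsLocalMax.fderiv_fderiv_nonpos`), and the second one is negative for `u ≠ 0`, since `df` is
injective. Summing over an orthonormal basis shows that the mean curvature vector has a negative
product with `∂_t` at `p`, so it does not vanish (`meanCurvature_productMetric_ne_zero`). The
contracting case is the same at a minimum of `t ∘ f`.
-/

/-! ### Inner products, normal parts and traces -/

section InnerAlgebra

variable {V : Type*} [AddCommGroup V] [Module ℝ V] [FiniteDimensional ℝ V]

theorem core_inner_sharp (c : InnerProductSpace.Core ℝ V) (ℓ : V →ₗ[ℝ] ℝ) (w : V) :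
    c.inner (sharp c ℓ) w = ℓ w := by
  let : NormedAddCommGroup V := c.toNormedAddCommGroup
  let : InnerProductSpace ℝ V := .ofCore c.toCore
  have : CompleteSpace V := FiniteDimensional.complete ℝ V
  exact InnerProductSpace.toDual_symm_apply (x := w) (y := LinearMap.toContinuousLinearMap ℓ)

/-- Projecting to the normal space does not change the inner product with a normal vector. -/
theorem core_inner_normalPart (c : InnerProductSpace.Core ℝ V) (W : Submodule ℝ V) (v z : V)
    (hz : ∀ w ∈ W, c.inner w z = 0) : c.inner (normalPart c W v) z = c.inner v z := by
  let : NormedAddCommGroup V := c.toNormedAddCommGroup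
  let : InnerProductSpace ℝ V := .ofCore c.toCore
  have : CompleteSpace V := FiniteDimensional.complete ℝ V
  have hz' : z ∈ Wᗮ := (Submodule.mem_orthogonal _ _).2 hz
  have h := Wᗮ.starProjection_inner_eq_zero v z hz'
  rw [inner_sub_left, sub_eq_zero] at h
  exact h.symm

theorem map_traceForm_neg (c : InnerProductSpace.Core ℝ V) {W : Type*} [AddCommMonoid W]
    (B : V → V → W) (φ : W →+ ℝ) (hV : 0 < Module.finrank ℝ V)
    (hφ : ∀ u, u ≠ 0 → φ (B u u) < 0) : φ (traceForm c B) < 0 := by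
  let : NormedAddCommGroup V := c.toNormedAddCommGroup
  let : InnerProductSpace ℝ V := .ofCore c.toCore
  have : NeZero (Module.finrank ℝ V) := ⟨hV.ne'⟩
  unfold traceForm
  rw [map_sum]
  exact Finset.sum_neg (fun i _ ↦ hφ _ ((stdOrthonormalBasis ℝ V).orthonormal.ne_zero i))
    Finset.univ_nonempty

end InnerAlgebra

/-! ### The second derivative test -/

section Calculus

theorem IsLocalMax.deriv_deriv_nonpos {h : ℝ → ℝ} {x : ℝ} (hx : IsLocalMax h x)
    (hc : ContinuousAt h x) : deriv (deriv h) x ≤ 0 := by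
  by_contra! hpos
  -- a positive second derivative would make `x` a local minimum as well, hence `h` locally constant
  have hmin := isLocalMin_of_deriv_deriv_pos hpos hx.deriv_eq_zero hc
  have heq : h =ᶠ[𝓝 x] fun _ ↦ h x := by
    filter_upwards [hx, hmin] with y h1 h2 using le_antisymm h1 h2
  have := heq.deriv.deriv_eq
  simp at this
  exact hpos.ne' this

variable {E E' : Type*} [NormedAddCommGroup E] [NormedSpace ℝ E]
  [NormedAddCommGroup E'] [NormedSpace ℝ E']

/-- The Hessian of `ℓ ∘ G` at a local maximum is negative semidefinite; for a linear functional `ℓ`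
it is `ℓ` applied to the second derivative of `G`. -/
theorem IsLocalMax.fderiv_fderiv_nonpos {G : E' → E} {ℓ : E →L[ℝ] ℝ} {x : E'}
    (hmax : IsLocalMax (fun y ↦ ℓ (G y)) x) (hG : ContDiffAt ℝ 2 G x) (u : E') :
    ℓ (fderiv ℝ (fderiv ℝ G) x u u) ≤ 0 := by
  have hline : ∀ s : ℝ, HasDerivAt (fun s : ℝ ↦ x + s • u) u s := fun s ↦ by
    simpa using ((hasDerivAt_id s).smul_const u).const_add x
  have hcont : Tendsto (fun s : ℝ ↦ x + s • u) (𝓝 0) (𝓝 x) := by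
    simpa using (hline 0).continuousAt.tendsto
  have hx0 : x = x + (0 : ℝ) • u := by simp
  have hev : ∀ᶠ y in 𝓝 x, DifferentiableAt ℝ G y := by
    filter_upwards [hG.eventually (by simp)] with y hy using hy.differentiableAt (by simp)
  have hd1 : deriv (fun s : ℝ ↦ ℓ (G (x + s • u))) =ᶠ[𝓝 0]
      fun s ↦ ℓ (fderiv ℝ G (x + s • u) u) := by
    filter_upwards [hcont.eventually hev] with s hs
    exact (ℓ.hasFDerivAt.comp_hasDerivAt s (hs.hasFDerivAt.comp_hasDerivAt s (hline s))).deriv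
  have hd2 : DifferentiableAt ℝ (fderiv ℝ G) (x + (0 : ℝ) • u) := by
    rw [← hx0]
    exact (hG.fderiv_right (m := 1) (by norm_num)).differentiableAt (by simp)
  have hd3 : HasDerivAt (fun s : ℝ ↦ ℓ (fderiv ℝ G (x + s • u) u))
      (ℓ (fderiv ℝ (fderiv ℝ G) x u u)) 0 := by
    have h := hd2.hasFDerivAt.comp_hasDerivAt (0 : ℝ) (hline 0)
    rw [← hx0] at h
    exact ℓ.hasFDerivAt.comp_hasDerivAt (0 : ℝ) (h.clm_apply (hasDerivAt_const _ u) |>.congr_deriv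
      (by simp))
  rw [← hd3.deriv, ← hd1.deriv_eq]
  refine IsLocalMax.deriv_deriv_nonpos ?_ ?_
  · have := hcont.eventually hmax
    simpa [IsLocalMax, IsMaxFilter] using this
  · refine ContinuousAt.comp (g := ℓ) ℓ.continuous.continuousAt ?_
    refine ContinuousAt.comp (g := G) ?_ (hline 0).continuousAt
    rw [← hx0]; exact hG.continuousAt

end Calculus

/-! ### Maps and metrics in charts of manifolds without boundary -/

section Charts

variable {E : Type*} [NormedAddCommGroup E] [NormedSpace ℝ E]
  {H : Type*} [TopologicalSpace H] {J : ModelWithCorners ℝ E H}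
  {F : Type*} [TopologicalSpace F] [ChartedSpace H F]
  {E' : Type*} [NormedAddCommGroup E'] [NormedSpace ℝ E']
  {H' : Type*} [TopologicalSpace H'] {I' : ModelWithCorners ℝ E' H'} [I'.Boundaryless]
  {S : Type*} [TopologicalSpace S] [ChartedSpace H' S]

theorem contDiffAt_writtenInExtChartAt {f : S → F} {p : S}
    (hf : ContMDiffAt I' J ∞ f p) :
    ContDiffAt ℝ ∞ (writtenInExtChartAt I' J p f) (extChartAt I' p p) := by
  have h := (contMDiffAt_iff.1 hf).2
  rwa [I'.range_eq_univ, contDiffWithinAt_univ] at h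

theorem mfderiv_eq_fderiv_writtenInExtChartAt {f : S → F} {p : S}
    (hf : MDifferentiableAt I' J f p) (u : E') :
    mfderiv I' J f p u = fderiv ℝ (writtenInExtChartAt I' J p f) (extChartAt I' p p) u := by
  rw [hf.mfderiv, I'.range_eq_univ, fderivWithin_univ]
  rfl

variable [J.Boundaryless] [IsManifold J ∞ F]

theorem mdifferentiableAt_extChartAt_symm {x : F} {y : E} (hy : y ∈ (extChartAt J x).target) :
    MDifferentiableAt 𝓘(ℝ, E) J (extChartAt J x).symm y := by
  have : IsManifold J 1 F := IsManifold.of_le (n := ∞) (by norm_num)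
  have h := _root_.mdifferentiableWithinAt_extChartAt_symm (I := J) hy
  rwa [J.range_eq_univ, mdifferentiableWithinAt_univ] at h

theorem injective_mfderiv_extChartAt_symm {x : F} :
    Function.Injective (mfderiv 𝓘(ℝ, E) J (extChartAt J x).symm (extChartAt J x x)) := by
  have : IsManifold J 1 F := IsManifold.of_le (n := ∞) (by norm_num)
  have h := isInvertible_mfderivWithin_extChartAt_symm (I := J) (mem_extChartAt_target x)
  rw [J.range_eq_univ, mfderivWithin_univ] at h
  exact h.injective

end Charts

section CoordMetric

variable {E : Type*} [NormedAddCommGroup E] [NormedSpace ℝ E]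
  {H : Type*} [TopologicalSpace H] {I : ModelWithCorners ℝ E H} [I.Boundaryless]
  {M : Type*} [TopologicalSpace M] [ChartedSpace H M] [IsManifold I ∞ M]

/-- The metric read in a chart is differentiable at the base point: it coincides near it with the
expression of the metric in the trivialization of the bundle of bilinear forms. Without this, the
`fderiv` in `christoffelLower` would be a junk value. -/
theorem differentiableAt_coordMetric
    (g : ContMDiffRiemannianMetric I ∞ E (fun x : M ↦ TangentSpace I x)) (x₀ : M) :
    DifferentiableAt ℝ (coordMetric g x₀) (extChartAt I x₀ x₀) := by
  have : IsManifold I 1 M := IsManifold.of_le (n := ∞) (by norm_num)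
  have h1 := ((contMDiffAt_hom_bundle _).1 (g.contMDiff x₀)).2
  have h2 : ContMDiffAt 𝓘(ℝ, E) I ∞ (extChartAt I x₀).symm (extChartAt I x₀ x₀) :=
    (contMDiffOn_extChartAt_symm x₀).contMDiffAt (extChartAt_target_mem_nhds x₀)
  rw [← extChartAt_to_inv (I := I) x₀] at h1
  have h3 := (ContMDiffAt.comp (extChartAt I x₀ x₀) (by simpa using h1)
    h2).contDiffAt.differentiableAt (by simp)
  refine h3.congr_of_eventuallyEq ?_
  filter_upwards [extChartAt_target_mem_nhds (I := I) x₀] with y hy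
  have hs : (extChartAt I x₀).symm y ∈ (chartAt H x₀).source := by
    simpa using (extChartAt I x₀).map_target hy
  have hb : (extChartAt I x₀).symm y ∈ (trivializationAt E (TangentSpace I) x₀).baseSet := by
    simpa using hs
  have key := TangentBundle.symmL_trivializationAt (I := I) hs
  rw [(extChartAt I x₀).right_inv hy, I.range_eq_univ, mfderivWithin_univ] at key
  ext u v
  have hsymm : ∀ w : E, (trivializationAt E (TangentSpace I) x₀).symm ((extChartAt I x₀).symm y) w =
      mfderiv 𝓘(ℝ, E) I (extChartAt I x₀).symm y w := fun w ↦
    ((trivializationAt E (TangentSpace I) x₀).symmL_apply hb w).symm.trans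
      (congrArg (fun A ↦ A w) key)
  simp only [Function.comp]
  rw [inCoordinates_apply_eq₂ hb hb (Set.mem_univ _), hsymm, hsymm]
  exact (congrArg (fun A : ℝ →ₗ[ℝ] ℝ ↦ A _) (Trivial.linearMapAt_trivialization ℝ M ℝ _)).symm

end CoordMetric

/-! ### The metric `β dt² + g_t` -/

section Product

variable {E : Type*} [NormedAddCommGroup E] [NormedSpace ℝ E]
  {H : Type*} [TopologicalSpace H] {J : ModelWithCorners ℝ E H}
  {F : Type*} [TopologicalSpace F] [ChartedSpace H F] {T : Opens ℝ}

theorem mem_extChartAt_source_opens_real (t s : T) : s ∈ (extChartAt 𝓘(ℝ, ℝ) t).source := by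
  rw [extChartAt_source, TopologicalSpace.Opens.chartAt_eq,
    OpenPartialHomeomorph.subtypeRestr_source]
  exact mem_chart_source ℝ (s : ℝ)

theorem riemannianMetricVectorSpace_real_apply (x a b : ℝ) :
    (riemannianMetricVectorSpace ℝ).inner x a b = a * b := mul_comm b a

theorem hasMFDerivAt_time (q : T × F) :
    HasMFDerivAt (𝓘(ℝ, ℝ).prod J) 𝓘(ℝ, ℝ) (fun q : T × F ↦ (q.1 : ℝ)) q
      (ContinuousLinearMap.fst ℝ ℝ E) :=
  (hasMFDerivAt_opens_val q.1).comp q (hasMFDerivAt_fst (I := 𝓘(ℝ, ℝ)) (I' := J) (x := q))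

variable [IsManifold J ∞ F]

/-- `∂_t` is orthogonal to the slices `{t} × F` and has squared length `β`. -/
theorem productForm_dt (β : T × F → ℝ)
    (g : T → ContMDiffRiemannianMetric J ∞ E (fun p : F ↦ TangentSpace J p)) (q : T × F)
    (u : TangentSpace (𝓘(ℝ, ℝ).prod J) q) :
    productForm β g q u ((1, 0) : ℝ × E) = β q * Prod.fst (α := ℝ) (β := E) u := by
  refine (productForm_apply β g q u _).trans ?_
  rw [(hasMFDerivAt_time q).mfderiv,
    (hasMFDerivAt_snd (I := 𝓘(ℝ, ℝ)) (I' := J) (x := q)).mfderiv]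
  have h : (g q.1).inner q.2 (ContinuousLinearMap.snd ℝ ℝ E u)
      (ContinuousLinearMap.snd ℝ ℝ E ((1, 0) : ℝ × E)) = 0 := map_zero ((g q.1).inner q.2 _)
  refine (congrArg₂ _ (congrArg _ ?_) h).trans (add_zero _)
  change (riemannianMetricVectorSpace ℝ).inner (q.1 : ℝ) (Prod.fst (α := ℝ) (β := E) u) (1 : ℝ) = _
  exact (riemannianMetricVectorSpace_real_apply _ _ _).trans (mul_one _)

variable [FiniteDimensional ℝ E] [J.Boundaryless]

/-- In the product chart the metric `β dt² + g_t` is block diagonal, its second block being the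
expression of `g_t` in the chart of `F`. -/
theorem coordMetric_productMetric (β : T × F → ℝ)
    (hβ : ContMDiff (𝓘(ℝ, ℝ).prod J) 𝓘(ℝ, ℝ) ∞ β) (hβ0 : ∀ q, 0 < β q)
    (g : T → ContMDiffRiemannianMetric J ∞ E (fun p : F ↦ TangentSpace J p))
    (hg : IsSmoothFamily g) (q : T × F) (y : ℝ × E)
    (hy : y ∈ (extChartAt (𝓘(ℝ, ℝ).prod J) q).target) (u v : ℝ × E) :
    coordMetric (productMetric β hβ hβ0 g hg) q y u v =
      β ((extChartAt (𝓘(ℝ, ℝ).prod J) q).symm y) * (u.1 * v.1) +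
      (g ((extChartAt (𝓘(ℝ, ℝ).prod J) q).symm y).1).inner ((extChartAt J q.2).symm y.2)
        (mfderiv 𝓘(ℝ, E) J (extChartAt J q.2).symm y.2 u.2)
        (mfderiv 𝓘(ℝ, E) J (extChartAt J q.2).symm y.2 v.2) := by
  have hd := mdifferentiableAt_extChartAt_symm (J := 𝓘(ℝ, ℝ).prod J) hy
  have hy2 : y.2 ∈ (extChartAt J q.2).target := by
    rw [extChartAt_prod] at hy; exact hy.2
  have h1 : ∀ u : ℝ × E, mfderiv (𝓘(ℝ, ℝ).prod J) 𝓘(ℝ, ℝ) (fun q : T × F ↦ (q.1 : ℝ))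
      ((extChartAt (𝓘(ℝ, ℝ).prod J) q).symm y)
      (mfderiv 𝓘(ℝ, ℝ × E) (𝓘(ℝ, ℝ).prod J) (extChartAt (𝓘(ℝ, ℝ).prod J) q).symm y u) = u.1 := by
    intro u
    have h3 := (hasMFDerivAt_time ((extChartAt (𝓘(ℝ, ℝ).prod J) q).symm
      y)).mdifferentiableAt.hasMFDerivAt.comp y hd.hasMFDerivAt
    have : (fun q : T × F ↦ (q.1 : ℝ)) ∘ (extChartAt (𝓘(ℝ, ℝ).prod J) q).symm =ᶠ[𝓝 y] Prod.fst := by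
      filter_upwards [(isOpen_extChartAt_target q).mem_nhds hy] with z hz
      exact congrArg Prod.fst ((extChartAt (𝓘(ℝ, ℝ).prod J) q).right_inv hz)
    have h4 := (hasFDerivAt_fst (𝕜 := ℝ) (p := y)).hasMFDerivAt.congr_of_eventuallyEq this
    exact congrArg (fun A ↦ A u) (hasMFDerivAt_unique h3 h4)
  have h2 : ∀ u : ℝ × E, mfderiv (𝓘(ℝ, ℝ).prod J) J (Prod.snd : T × F → F)
      ((extChartAt (𝓘(ℝ, ℝ).prod J) q).symm y)
      (mfderiv 𝓘(ℝ, ℝ × E) (𝓘(ℝ, ℝ).prod J) (extChartAt (𝓘(ℝ, ℝ).prod J) q).symm y u) =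
      mfderiv 𝓘(ℝ, E) J (extChartAt J q.2).symm y.2 u.2 := by
    intro u
    have h4 := (mdifferentiableAt_snd (x := (extChartAt (𝓘(ℝ, ℝ).prod J) q).symm
      y)).hasMFDerivAt.comp y hd.hasMFDerivAt
    have : (Prod.snd : T × F → F) ∘ (extChartAt (𝓘(ℝ, ℝ).prod J) q).symm =
        (extChartAt J q.2).symm ∘ Prod.snd := by
      rw [extChartAt_prod]; rfl
    have h3 := (mdifferentiableAt_extChartAt_symm hy2).hasMFDerivAt.comp y
      (f := (Prod.snd : ℝ × E → E)) (hasFDerivAt_snd.hasMFDerivAt)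
    rw [← this] at h3
    exact congrArg (fun A ↦ A u) (hasMFDerivAt_unique h4 h3)
  refine (productForm_apply β g _ _ _).trans ?_
  -- `erw`, because coordinate vectors are identified with tangent vectors up to unfolding
  erw [h1, h1, h2, h2]
  exact congrArg₂ (· + ·) (congrArg _ (riemannianMetricVectorSpace_real_apply _ _ _)) rfl

/-- For `w` tangent to the slice, the lowered Christoffel symbol satisfies
`Γ(w, w)(∂_t) = - (∂_t g_t)(w, w) / 2`. Here `w` is a coordinate vector, and the differential of the
inverse chart turns it into a tangent vector of `F`. -/
theorem christoffelLower_productMetric (β : T × F → ℝ)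
    (hβ : ContMDiff (𝓘(ℝ, ℝ).prod J) 𝓘(ℝ, ℝ) ∞ β) (hβ0 : ∀ q, 0 < β q)
    (g : T → ContMDiffRiemannianMetric J ∞ E (fun p : F ↦ TangentSpace J p))
    (hg : IsSmoothFamily g) (q : T × F) (w : E) :
    christoffelLower (productMetric β hβ hβ0 g hg) q (0, w) (0, w) (1, 0) =
      -(1 / 2) * timeDeriv (fun s ↦ (g s).inner q.2
        (mfderiv 𝓘(ℝ, E) J (extChartAt J q.2).symm (extChartAt J q.2 q.2) w)
        (mfderiv 𝓘(ℝ, E) J (extChartAt J q.2).symm (extChartAt J q.2 q.2) w)) q.1 := by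
  set y₀ : ℝ × E := extChartAt (𝓘(ℝ, ℝ).prod J) q q with hy₀
  set C := coordMetric (productMetric β hβ hβ0 g hg) q with hC
  have hy₀' : y₀ = ((q.1 : ℝ), extChartAt J q.2 q.2) := by
    rw [hy₀, extChartAt_prod]; rfl
  have hd := (differentiableAt_coordMetric (productMetric β hβ hβ0 g hg) q).hasFDerivAt
  rw [← hy₀, ← hC] at hd
  have happ : ∀ u v : ℝ × E, HasFDerivAt (fun y ↦ C y u v)
      (((fderiv ℝ C y₀).flip u).flip v) y₀ := fun u v ↦ by
    have := (hd.clm_apply (hasFDerivAt_const u y₀)).clm_apply (hasFDerivAt_const v y₀)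
    refine this.congr_fderiv ?_
    ext z <;> simp
  -- the mixed components of the metric vanish identically
  have hmix : ∀ z, fderiv ℝ C y₀ z (0, w) (1, 0) = 0 := fun z ↦ by
    have h0 : (fun y ↦ C y (0, w) (1, 0)) =ᶠ[𝓝 y₀] fun _ ↦ 0 := by
      filter_upwards [extChartAt_target_mem_nhds (I := 𝓘(ℝ, ℝ).prod J) q] with y hy
      rw [hC, coordMetric_productMetric β hβ hβ0 g hg q y hy]
      have hz (b : ℝ) : b * ((0 : ℝ) * 1) = 0 := by simp
      have hz' (t : T) (p : F) (A : E →L[ℝ] TangentSpace J p) (X : TangentSpace J p) :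
          (g t).inner p X (A 0) = 0 := by rw [map_zero, map_zero]
      refine (congrArg₂ (· + ·) (hz _) (hz' _ _ _ _)).trans (add_zero (0 : ℝ))
    have := (happ (0, w) (1, 0)).fderiv
    rw [h0.fderiv_eq, fderiv_fun_const] at this
    simpa using (congrArg (fun A ↦ A z) this).symm
  -- `∂_t g_t` is the derivative of the coordinate expression along the line in the direction `(1, 0)`
  have htime : timeDeriv (fun s ↦ (g s).inner q.2
        (mfderiv 𝓘(ℝ, E) J (extChartAt J q.2).symm (extChartAt J q.2 q.2) w)
        (mfderiv 𝓘(ℝ, E) J (extChartAt J q.2).symm (extChartAt J q.2 q.2) w)) q.1 =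
      fderiv ℝ C y₀ (1, 0) (0, w) (0, w) := by
    have hline : HasFDerivAt (fun s : ℝ ↦ ((s, extChartAt J q.2 q.2) : ℝ × E))
        (ContinuousLinearMap.inl ℝ ℝ E) (q.1 : ℝ) :=
      (hasFDerivAt_id (𝕜 := ℝ) (q.1 : ℝ)).prodMk (hasFDerivAt_const _ _)
    have hψ := HasFDerivAt.comp (q.1 : ℝ) (hy₀' ▸ happ (0, w) (0, w)) hline
    have hφ := HasMFDerivAt.comp q.1 hψ.hasMFDerivAt (hasMFDerivAt_opens_val q.1)
    have heq : (fun s ↦ (g s).inner q.2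
        (mfderiv 𝓘(ℝ, E) J (extChartAt J q.2).symm (extChartAt J q.2 q.2) w)
        (mfderiv 𝓘(ℝ, E) J (extChartAt J q.2).symm (extChartAt J q.2 q.2) w)) =
        ((fun y ↦ C y (0, w) (0, w)) ∘ fun s : ℝ ↦ ((s, extChartAt J q.2 q.2) : ℝ × E)) ∘
          (Subtype.val : T → ℝ) := by
      funext s
      have hmem : ((s : ℝ), extChartAt J q.2 q.2) ∈ (extChartAt (𝓘(ℝ, ℝ).prod J) q).target := by
        rw [extChartAt_prod]
        exact ⟨(extChartAt 𝓘(ℝ, ℝ) q.1).map_source (mem_extChartAt_source_opens_real q.1 s),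
          mem_extChartAt_target q.2⟩
      have hinv : ((extChartAt (𝓘(ℝ, ℝ).prod J) q).symm ((s : ℝ), extChartAt J q.2 q.2)).1 = s := by
        rw [extChartAt_prod]
        exact (extChartAt 𝓘(ℝ, ℝ) q.1).left_inv (mem_extChartAt_source_opens_real q.1 s)
      refine ((coordMetric_productMetric β hβ hβ0 g hg q _ hmem (0, w) (0, w)).trans ?_).symm
      have hz (b : ℝ) : b * ((0 : ℝ) * 0) = 0 := by simp
      refine (congrArg₂ (· + ·) (hz _) ?_).trans (zero_add (_ : ℝ))
      -- stated for a variable base point, because the type of the bilinear form depends on it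
      have hbase : ∀ p, p = q.2 → ∀ X : E, (g s).inner p X X = (g s).inner q.2 X X := by
        rintro _ rfl _; rfl
      rw [hinv]
      exact hbase _ (extChartAt_to_inv q.2) _
    unfold timeDeriv
    rw [heq, hφ.mfderiv, hy₀']
    rfl
  rw [htime]
  simp only [christoffelLower]
  rw [← hC, ← hy₀]
  simp [hmix]

end Product

/-! ### Submanifolds of `T × F` at extrema of the height -/

section Height

variable {E : Type*} [NormedAddCommGroup E] [NormedSpace ℝ E]
  {H : Type*} [TopologicalSpace H] {J : ModelWithCorners ℝ E H}
  {F : Type*} [TopologicalSpace F] [ChartedSpace H F]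
  [FiniteDimensional ℝ E] [J.Boundaryless] [IsManifold J ∞ F] {T : Opens ℝ}
  {E' : Type*} [NormedAddCommGroup E'] [NormedSpace ℝ E']
  {H' : Type*} [TopologicalSpace H'] {I' : ModelWithCorners ℝ E' H'}
  {S : Type*} [TopologicalSpace S] [ChartedSpace H' S]

/-- Where the submanifold is tangent to the slice, the `dt`-component of its second fundamental
form is the Hessian of the height `t ∘ f` in the chart, minus `(∂_t g_t) / (2 β)`: since `∂_t` is
normal there, the projection to the normal space is immaterial. -/
theorem mul_fst_secondFundamentalForm (β : T × F → ℝ)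
    (hβ : ContMDiff (𝓘(ℝ, ℝ).prod J) 𝓘(ℝ, ℝ) ∞ β) (hβ0 : ∀ q, 0 < β q)
    (g : T → ContMDiffRiemannianMetric J ∞ E (fun p : F ↦ TangentSpace J p))
    (hg : IsSmoothFamily g) (f : S → T × F) (p : S)
    (hhor : ∀ u : E', Prod.fst (α := ℝ) (β := E) (mfderiv I' (𝓘(ℝ, ℝ).prod J) f p u) = 0)
    (u : E') :
    β (f p) * Prod.fst (α := ℝ) (β := E)
        (secondFundamentalForm (productMetric β hβ hβ0 g hg) I' f p u u) =
      β (f p) * (fderiv ℝ (fderiv ℝ (writtenInExtChartAt I' (𝓘(ℝ, ℝ).prod J) p f))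
        (extChartAt I' p p) u u).1 -
      1 / 2 * timeDeriv (fun s ↦ (g s).inner (f p).2
        (mfderiv 𝓘(ℝ, E) J (extChartAt J (f p).2).symm (extChartAt J (f p).2 (f p).2)
          (Prod.snd (α := ℝ) (β := E) (mfderiv I' (𝓘(ℝ, ℝ).prod J) f p u)))
        (mfderiv 𝓘(ℝ, E) J (extChartAt J (f p).2).symm (extChartAt J (f p).2 (f p).2)
          (Prod.snd (α := ℝ) (β := E) (mfderiv I' (𝓘(ℝ, ℝ).prod J) f p u)))) (f p).1 := by
  set G := productMetric β hβ hβ0 g hg with hG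
  have hdt : ∀ v : ℝ × E, G.inner (f p) v ((1, 0) : ℝ × E) = β (f p) * v.1 :=
    fun v ↦ productForm_dt β g (f p) v
  set w : E := Prod.snd (α := ℝ) (β := E) (mfderiv I' (𝓘(ℝ, ℝ).prod J) f p u) with hw
  have hdf : mfderiv I' (𝓘(ℝ, ℝ).prod J) f p u = ((0, w) : ℝ × E) := Prod.ext (hhor u) rfl
  have hnormal : ∀ v ∈ LinearMap.range (mfderiv I' (𝓘(ℝ, ℝ).prod J) f p).toLinearMap,
      G.inner (f p) v ((1, 0) : ℝ × E) = 0 := by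
    rintro _ ⟨x, rfl⟩
    exact (hdt _).trans ((congrArg (β (f p) * ·) (hhor x)).trans (mul_zero _))
  have h1 := core_inner_normalPart (G.toRiemannianMetric.toCore (f p)) _
    (covariantHessian G I' f p u u) ((1, 0) : ℝ × E) hnormal
  have hΓ := (hdt (christoffel G (f p) ((0, w) : ℝ × E) ((0, w) : ℝ × E))).symm.trans
    ((core_inner_sharp (G.toRiemannianMetric.toCore (f p))
      (christoffelLower G (f p) (0, w) (0, w)).toLinearMap ((1, 0) : ℝ × E)).trans
        (christoffelLower_productMetric β hβ hβ0 g hg (f p) w))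
  have hcov : covariantHessian G I' f p u u =
      (fderiv ℝ (fderiv ℝ (writtenInExtChartAt I' (𝓘(ℝ, ℝ).prod J) p f))
        (extChartAt I' p p) u u : ℝ × E) +
      (show ℝ × E from christoffel G (f p) ((0, w) : ℝ × E) ((0, w) : ℝ × E)) := by
    unfold covariantHessian
    rw [hdf]
    rfl
  refine (hdt _).symm.trans (h1.trans ((hdt _).trans ?_))
  refine (congrArg (fun v : ℝ × E ↦ β (f p) * v.1) hcov).trans ((mul_add (β (f p)) _ _).trans ?_)
  refine (congrArg (_ + ·) hΓ).trans ?_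
  ring

variable [FiniteDimensional ℝ E'] [I'.Boundaryless]

/-- The mean curvature does not vanish at a maximum of `ε t`, where `ε` is such that `g_t` is
strictly increasing in the direction `ε ∂_t`: there the submanifold is tangent to the slice, and
every `ε dt(II(u, u))` with `u ≠ 0` is negative. -/
theorem meanCurvature_productMetric_ne_zero (β : T × F → ℝ)
    (hβ : ContMDiff (𝓘(ℝ, ℝ).prod J) 𝓘(ℝ, ℝ) ∞ β) (hβ0 : ∀ q, 0 < β q)
    (g : T → ContMDiffRiemannianMetric J ∞ E (fun p : F ↦ TangentSpace J p))
    (hg : IsSmoothFamily g) {f : S → T × F}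
    (hf : IsSmoothImmersion I' (𝓘(ℝ, ℝ).prod J) f) (hE' : 0 < Module.finrank ℝ E')
    (p : S) {ε : ℝ} (hε : ε ≠ 0) (hmax : ∀ x, ε * ((f x).1 : ℝ) ≤ ε * ((f p).1 : ℝ))
    (hmono : ∀ t p (X : TangentSpace J p), X ≠ 0 →
      0 < ε * timeDeriv (fun s ↦ (g s).inner p X X) t) :
    meanCurvature (productMetric β hβ hβ0 g hg) hf p ≠ 0 := by
  set W := writtenInExtChartAt I' (𝓘(ℝ, ℝ).prod J) p f with hW
  set y₀ := extChartAt I' p p with hy₀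
  have hWd : ContDiffAt ℝ ∞ W y₀ := contDiffAt_writtenInExtChartAt (hf.contMDiff p)
  let ℓ : ℝ × E →L[ℝ] ℝ := ε • ContinuousLinearMap.fst ℝ ℝ E
  have hWmax : IsLocalMax (fun y ↦ ℓ (W y)) y₀ := by
    refine Eventually.of_forall fun y ↦ ?_
    -- the `T`-component of the chart at `f p` is the inclusion of `T` into `ℝ` on all of `T`, so
    -- `ℓ ∘ W` is `ε t ∘ f` read in the chart of `S`
    have h0 : W y₀ = extChartAt (𝓘(ℝ, ℝ).prod J) (f p) (f p) :=
      congrArg (fun x ↦ extChartAt (𝓘(ℝ, ℝ).prod J) (f p) (f x)) (extChartAt_to_inv p)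
    simp only [h0]
    exact hmax _
  have hhor : ∀ u : E',
      Prod.fst (α := ℝ) (β := E) (mfderiv I' (𝓘(ℝ, ℝ).prod J) f p u) = 0 := fun u ↦ by
    have h1 := ℓ.hasFDerivAt.comp y₀ (hWd.differentiableAt (by simp)).hasFDerivAt
    have h2 : ε * (fderiv ℝ W y₀ u).1 = 0 :=
      congrArg (fun A ↦ A u) (hWmax.hasFDerivAt_eq_zero h1)
    rw [mfderiv_eq_fderiv_writtenInExtChartAt ((hf.contMDiff p).mdifferentiableAt (by simp))]
    exact (mul_eq_zero.1 h2).resolve_left hε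
  intro hH
  have hcoef : (1 / (Module.finrank ℝ E' : ℝ)) ≠ 0 := by positivity
  have htr := (smul_eq_zero.1 hH).resolve_left hcoef
  let φ : TangentSpace (𝓘(ℝ, ℝ).prod J) (f p) →+ ℝ := ℓ.toLinearMap.toAddMonoidHom
  have hneg := map_traceForm_neg (inducedCore (productMetric β hβ hβ0 g hg) hf p)
    (secondFundamentalForm (productMetric β hβ hβ0 g hg) I' f p) φ hE' ?_
  · rw [htr, map_zero] at hneg
    exact hneg.false
  intro u hu
  have key := mul_fst_secondFundamentalForm β hβ hβ0 g hg f p hhor u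
  have h2 : ε * (fderiv ℝ (fderiv ℝ W) y₀ u u).1 ≤ 0 :=
    hWmax.fderiv_fderiv_nonpos (contDiffAt_infty.1 hWd 2) u
  have hw : Prod.snd (α := ℝ) (β := E) (mfderiv I' (𝓘(ℝ, ℝ).prod J) f p u) ≠ 0 := fun h0 ↦
    hu (hf.injective_mfderiv p ((Prod.ext (hhor u) h0 : _ = (0 : ℝ × E)).trans (map_zero _).symm))
  have h3 := hmono (f p).1 (f p).2 (mfderiv 𝓘(ℝ, E) J (extChartAt J (f p).2).symm
    (extChartAt J (f p).2 (f p).2)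
    (Prod.snd (α := ℝ) (β := E) (mfderiv I' (𝓘(ℝ, ℝ).prod J) f p u)))
    fun h0 ↦ hw (injective_mfderiv_extChartAt_symm (h0.trans (map_zero _).symm))
  change ε * Prod.fst (α := ℝ) (β := E) _ < 0
  refine neg_of_mul_neg_right (a := β (f p)) ?_ (hβ0 (f p)).le
  have h4 := mul_nonpos_of_nonneg_of_nonpos (hβ0 (f p)).le h2
  linear_combination ε * key + h4 + (1 / 2) * h3

end Height

theorem mainTheorem2 {k n : ℕ} (hn : 1 ≤ n)
    {F : Type*} [TopologicalSpace F] [ChartedSpace (EuclideanSpace ℝ (Fin k)) F]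
    [IsManifold (𝓡 k) ∞ F]
    (T : Opens ℝ) (hT : (T : Set ℝ).OrdConnected)
    (β : T × F → ℝ) (hβ : ContMDiff (𝓘(ℝ, ℝ).prod (𝓡 k)) 𝓘(ℝ, ℝ) ∞ β) (hβ0 : ∀ q, 0 < β q)
    (g : T → ContMDiffRiemannianMetric (𝓡 k) ∞ (EuclideanSpace ℝ (Fin k))
      (fun p : F ↦ TangentSpace (𝓡 k) p))
    (hg : IsSmoothFamily g) (hmono : IsStrictlyMonotone β g)
    {S : Type*} [TopologicalSpace S] [ChartedSpace (EuclideanSpace ℝ (Fin n)) S]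
    [IsManifold (𝓡 n) ∞ S] [CompactSpace S] [Nonempty S]
    (f : S → T × F) (hf : IsSmoothImmersion (𝓡 n) (𝓘(ℝ, ℝ).prod (𝓡 k)) f) :
    ¬ IsMinimal (productMetric β hβ hβ0 g hg) hf := by
  intro hmin
  have hdim : 0 < Module.finrank ℝ (EuclideanSpace ℝ (Fin n)) := by
    rw [finrank_euclideanSpace_fin]; exact hn
  have hcont : Continuous fun x ↦ ((f x).1 : ℝ) :=
    continuous_subtype_val.comp (continuous_fst.comp hf.contMDiff.continuous)
  rcases hmono with ⟨-, hexp⟩ | ⟨-, hcontr⟩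
  · obtain ⟨p, -, hp⟩ := isCompact_univ.exists_isMaxOn univ_nonempty hcont.continuousOn
    exact meanCurvature_productMetric_ne_zero β hβ hβ0 g hg hf hdim p one_ne_zero
      (fun x ↦ by simpa using hp (mem_univ x)) (fun t p X hX ↦ by simpa using hexp t p X hX)
      (hmin p)
  · obtain ⟨p, -, hp⟩ := isCompact_univ.exists_isMinOn univ_nonempty hcont.continuousOn
    exact meanCurvature_productMetric_ne_zero β hβ hβ0 g hg hf hdim p (neg_ne_zero.2 one_ne_zero)
      (fun x ↦ by simpa using hp (mem_univ x)) (fun t p X hX ↦ by simpa using hcontr t p X hX)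
      (hmin p)
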